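/- Let $X,Y$ be real Banach spaces, $X$ uniformly convex and smooth, $Y$ arbitrary. Let $p,q,r\in(1,\infty)$ with $\frac1p+\frac1q=1$. For a normed space $E$ and $a>1$ the duality mapping is $J_a^E(u)=\{f\in E^*:\ f(u)=\|u\|^a,\ \|f\|=\|u\|^{a-1}\}$. Since $X$ is smooth, $J_p:=J_p^X$ is single-valued; assume that it is sequentially weak-to-weak continuous, i.e. $u_n\rightharpoonup u$ in $X$ implies $J_p(u_n)\rightharpoonup J_p(u)$ in $X^*$. Let $j_Y$ be an arbitrary single-valued selection of $J_r^Y$. Let $J_q^*$ be the duality mapping $J_q^{X^*}$ of $X^*$, with $X^{**}$ identified with $X$. Let $A:X\to Y$ be a continuous linear operator with dual $A^*:Y^*\to X^*$, let $y\in\mathcal R(A)$, and put $M:=\{x\in X: Ax=y\}$. The Bregman distance is $\Delta_p(x,z)=\frac1p\|z\|^p-\frac1p\|x\|^p-\langle J_p(x),z-x\rangle$, and the Bregman projection of $x$ onto $M$ is the unique minimizer of $\Delta_p(x,\cdot)$ over $M$. Method. Let $N_n$, $n\ge0$, be integers with $1\le N_n\le n+1$, and let $x_0\in X$ satisfy $J_p(x_0)\in\overline{\mathcal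 R(A^*)}$. For $n=0,1,2,\dots$: 1. If $Ax_n=y$, stop. 2. Let $d_n=A^*j_Y(Ax_n-y)$ be the Landweber direction. Choose real $s_{n,m}$ such that $\sum_m s_{n,m}v_m$ is the metric projection of $d_n$ onto $V_{n-1}$ (a nearest point of $V_{n-1}$ to $d_n$ in the norm of $X^*$), where the sum runs over the search directions $v_m$ that span $V_{n-1}$, and $V_{-1}=\{0\}$. Put $o_n=j_Y(Ax_n-y)-\sum_m s_{n,m}o_m\in Y^*$ and $v_n=A^*o_n=d_n-\sum_m s_{n,m}v_m$. 3. The search space is spanned by the last $N_n$ of these directions, $V_n=\operatorname{span}\{v_{n-N_n+1},\dots,v_n\}$, with offsets $\beta_m=\langle o_m,y\rangle$. 4. Let $(t_{n,m})_{n-N_n<m\le n}$ minimize $h_n(t)=\frac1q\big\|J_p(x_n)-\sum_m t_mv_m\big\|^q+\sum_m t_m\beta_m$ over $\mathbb R^{N_n}$, and put $x_{n+1}=J_q^*\big(J_p(x_n)-\sum_m t_{n,m}v_m\big)$. Theorem. The Bregman projection $x^\dagger$ of $x_0$ onto $M$ exists, and it is the unique element of $M$ of minimal norm. Either the method stops after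 finitely many steps at some $n$, and then $x_n=x^\dagger$, or it never stops and $x_n\rightharpoonup x^\dagger$ weakly in $X$. -/

import Mathlib

open Filter Topology

noncomputable section

namespace Sesop

variable {E : Type*} [NormedAddCommGroup E] [NormedSpace ℝ E]
variable {X : Type*} [NormedAddCommGroup X] [NormedSpace ℝ X]
variable {Y : Type*} [NormedAddCommGroup Y] [NormedSpace ℝ Y]

/-! ### Geometry of Banach spaces -/

/-- A normed space is smooth if every nonzero vector has exactly one norming functional of norm
one. -/
def IsSmooth (E : Type*) [NormedAddCommGroup E] [NormedSpace ℝ E] : Prop :=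
  ∀ x : E, x ≠ 0 → ∃! f : StrongDual ℝ E, ‖f‖ = 1 ∧ f x = ‖x‖

/-- Weak convergence of a sequence: convergence in the topology `σ(E, E*)`. -/
def WeaklyConverges (u : ℕ → E) (a : E) : Prop :=
  Tendsto (fun n => toWeakSpace ℝ E (u n)) atTop (𝓝 (toWeakSpace ℝ E a))

/-- The set-valued duality mapping of `E` with gauge function `t ↦ t ^ (p - 1)`. -/
def dualityMapping (p : ℝ) (x : E) : Set (StrongDual ℝ E) :=
  {f | f x = ‖x‖ ^ p ∧ ‖f‖ = ‖x‖ ^ (p - 1)}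

theorem dualityMapping_nonempty {p : ℝ} (hp : 1 < p) (x : E) :
    (dualityMapping p x).Nonempty := by
  by_cases hx : x = 0
  · refine ⟨0, ?_, ?_⟩
    · simp [hx, Real.zero_rpow (by linarith : p ≠ 0)]
    · simp [hx, Real.zero_rpow (by linarith : p - 1 ≠ 0)]
  · have hx' : ‖x‖ ≠ 0 := norm_ne_zero_iff.mpr hx
    obtain ⟨g, hg1, hg2⟩ := exists_dual_vector ℝ x hx'
    refine ⟨(‖x‖ ^ (p - 1)) • g, ?_, ?_⟩
    · have h : g x = ‖x‖ := by simpa using hg2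
      rw [smul_apply, h, smul_eq_mul]
      conv_lhs => rw [← Real.rpow_one ‖x‖, ← Real.rpow_mul (norm_nonneg x)]
      rw [one_mul, ← Real.rpow_add (lt_of_le_of_ne (norm_nonneg x) hx'.symm)]
      congr 1
      ring
    · rw [norm_smul, hg1, mul_one, Real.norm_of_nonneg (by positivity)]

/-- A single-valued selection of the duality mapping. On a smooth space, where the duality mapping
is single-valued, it is the duality mapping itself. -/
def dualityMap (p : ℝ) (x : E) : StrongDual ℝ E :=
  Classical.epsilon fun f => f ∈ dualityMapping p x

theorem dualityMap_mem {p : ℝ} (hp : 1 < p) (x : E) :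
    dualityMap p x ∈ dualityMapping p x :=
  Classical.epsilon_spec (dualityMapping_nonempty hp x)

/-- The duality mapping is sequentially weak-to-weak continuous. -/
def DualityMapWeakContinuous (p : ℝ) (E : Type*) [NormedAddCommGroup E] [NormedSpace ℝ E] : Prop :=
  ∀ (u : ℕ → E) (a : E), WeaklyConverges u a →
    WeaklyConverges (fun n => dualityMap p (u n)) (dualityMap p a)

/-! ### Projections -/

/-- `b` is a metric projection of `x` onto `C`, i.e. a point of `C` nearest to `x` (there is at
most one if `C` is convex and the norm is strictly convex). -/
def IsMetricProjection (C : Set E) (x b : E) : Prop :=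
  b ∈ C ∧ ∀ c ∈ C, ‖x - b‖ ≤ ‖x - c‖

/-- The Bregman distance of `x` to `z` with respect to `f = ‖·‖ ^ p / p`, whose derivative is the
duality mapping on a smooth space. -/
def bregmanDistance (p : ℝ) (x z : E) : ℝ :=
  ‖z‖ ^ p / p - ‖x‖ ^ p / p - dualityMap p x (z - x)

/-- `b` is the Bregman projection of `x` onto `C`: the unique point of `C` that minimizes the
Bregman distance of `x` to the points of `C`. -/
def IsBregmanProjection (p : ℝ) (C : Set E) (x b : E) : Prop :=
  b ∈ C ∧ ∀ c ∈ C, c ≠ b → bregmanDistance p x b < bregmanDistance p x c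

/-! ### The method -/

/-- The dual operator `A* : Y* → X*`. -/
def dualOp (A : X →L[ℝ] Y) : StrongDual ℝ Y →L[ℝ] StrongDual ℝ X :=
  A.precomp ℝ

/-- The solution set `{x | A x = y}`. -/
def solutionSet (A : X →L[ℝ] Y) (y : Y) : Set X := {x | A x = y}

/-- The labels of the (at most) `N n` most recent search directions at step `n`, namely
`n - N n + 1, …, n`. -/
def window (N : ℕ → ℕ) (n : ℕ) : Finset ℕ := Finset.Icc (n + 1 - N n) n

/-- The labels of the search directions of the preceding step; there are none at step `0`. -/
def prevWindow (N : ℕ → ℕ) : ℕ → Finset ℕ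
  | 0 => ∅
  | n + 1 => window N n

/-- The search space spanned by the directions `v m = A* (o m)` with label `m ∈ W`. -/
def searchSpace (A : X →L[ℝ] Y) (o : ℕ → StrongDual ℝ Y) (W : Finset ℕ) :
    Submodule ℝ (StrongDual ℝ X) :=
  Submodule.span ℝ ((fun m => dualOp A (o m)) '' (W : Set ℕ))

/-- The line search functional
`h_n(t) = ‖J x_n - ∑ t_m v_m‖ ^ q / q + ∑ t_m β_m`, where `v_m = A* (o m)` and `β_m = ⟨o m, y⟩`,
with sums over the labels `m` of the search directions of step `n`. -/
def lineSearch (p q : ℝ) (A : X →L[ℝ] Y) (y : Y) (o : ℕ → StrongDual ℝ Y) (W : Finset ℕ) (xn : X)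
    (t : ℕ → ℝ) : ℝ :=
  ‖dualityMap p xn - ∑ m ∈ W, t m • dualOp A (o m)‖ ^ q / q + ∑ m ∈ W, t m * o m y

/-- `x` is a sequence of iterates of the sequential subspace method with semi-orthogonalized
truncated search spaces, where
* `jY` is the chosen selection of the duality mapping of `Y`;
* `N n` is the number of search directions at step `n`;
* `o n` is the precursor of the new orthogonalized search direction `A* (o n)` of step `n`, so that
  the `k`-th search direction of step `n` is `A* (o (n - N n + k))` for `k = 1, …, N n`;
* `s n` are the orthogonalization coefficients and `t n` the step widths of step `n`.

Step `n` is executed only if none of the iterates `x 0, …, x n` is a solution; the values of the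
sequences after the method has stopped are irrelevant. -/
structure IsRun (p q : ℝ) (A : X →L[ℝ] Y) (y : Y) (jY : Y → StrongDual ℝ Y) (N : ℕ → ℕ)
    (x : ℕ → X) (o : ℕ → StrongDual ℝ Y) (s t : ℕ → ℕ → ℝ) : Prop where
  /-- The admissible initial values. -/
  initial : dualityMap p (x 0) ∈ closure (Set.range (dualOp A))
  /-- The coefficients `s n` represent the metric projection of the Landweber direction onto the
  preceding search space. -/
  projection : ∀ n, (∀ m ≤ n, A (x m) ≠ y) →
    IsMetricProjection (searchSpace A o (prevWindow N n) : Set (StrongDual ℝ X))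
      (dualOp A (jY (A (x n) - y))) (∑ m ∈ prevWindow N n, s n m • dualOp A (o m))
  /-- The new search direction is the Landweber direction minus that projection. -/
  direction : ∀ n, (∀ m ≤ n, A (x m) ≠ y) →
    o n = jY (A (x n) - y) - ∑ m ∈ prevWindow N n, s n m • o m
  /-- The step widths minimize the line search functional. -/
  stepwidth : ∀ n, (∀ m ≤ n, A (x m) ≠ y) →
    ∀ τ : ℕ → ℝ, lineSearch p q A y o (window N n) (x n) (t n)
      ≤ lineSearch p q A y o (window N n) (x n) τ
  /-- The new iterate is the image of `J x_n - ∑ t_m v_m` under the duality mapping of `X*` with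
  gauge function `t ↦ t ^ (q - 1)`, where `X` is regarded as a subspace of `X**`. -/
  update : ∀ n, (∀ m ≤ n, A (x m) ≠ y) →
    NormedSpace.inclusionInDoubleDual ℝ X (x (n + 1)) ∈
      dualityMapping q (dualityMap p (x n) - ∑ m ∈ window N n, t n m • dualOp A (o m))

end Sesop

end

/-! Each step subtracts elements of the range of `A*` from `J x_n`, so every `J x_n` stays in the
closure of that range. Functionals there are constant on solutions. Hence on `M` the Bregman
distance of `x 0` is `‖·‖ ^ p / p` up to a constant, and a solution `b` with `J b` in the closure
has minimal norm, because `‖b‖ ^ p = ⟨J b, z⟩ ≤ ‖b‖ ^ (p - 1) * ‖z‖` for every solution `z`. This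
settles finite termination. Otherwise, weak continuity of `J` passes the invariant to weak limit
points, and it remains to prove boundedness and vanishing residuals.

For a solution `z`, `D_n = ‖J x_n‖ ^ q / q - ⟨J x_n, z⟩` decreases and is coercive, so the iterates
are bounded. Exact line search makes the used `o m` annihilate the next residual; thus
orthogonalization leaves `⟨o n, A x_n - y⟩ = ‖A x_n - y‖ ^ r` intact, while the metric projection
keeps `v_n` no longer than the Landweber direction. As `X` is uniformly convex, `‖·‖ ^ q / q` is
uniformly smooth on bounded sets of `X*`, so a residual of size at least `ε` forces `D_n` to drop by
a fixed amount. Since `D_n` converges, the residuals tend to zero. -/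

noncomputable section

namespace Sesop

/-! ### Uniform convexity: nested convex sets, minimal norm, norm attainment -/

section UniformConvexity

variable {E : Type*} [NormedAddCommGroup E] [NormedSpace ℝ E] [UniformConvexSpace E]

/-- A form of uniform convexity in which the radius need not be attained exactly. -/
theorem exists_pos_norm_sub_lt {d : ℝ} (hd : 0 ≤ d) {ε : ℝ} (hε : 0 < ε) :
    ∃ δ > 0, ∀ x y : E, ‖x‖ ≤ d + δ → ‖y‖ ≤ d + δ → 2 * d - δ ≤ ‖x + y‖ → ‖x - y‖ < ε := by
  obtain ⟨δ₀, hδ₀, h⟩ := exists_forall_closed_ball_dist_add_le_two_mul_sub E (half_pos hε) d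
  -- Scaling by `d / (d + δ)` moves each vector by at most `δ`; the argument needs `3 * δ < δ₀` and
  -- `ε / 2 + 2 * δ < ε`.
  set δ := min (δ₀ / 4) (ε / 8)
  have hδ : 0 < δ := lt_min (by positivity) (by positivity)
  have h1 : δ ≤ δ₀ / 4 := min_le_left _ _
  have h2 : δ ≤ ε / 8 := min_le_right _ _
  refine ⟨δ, hδ, fun x y hx hy hxy => ?_⟩
  have hsum : 0 < d + δ := by linarith
  set c := d / (d + δ)
  have hc0 : 0 ≤ c := by positivity
  have hcd : c * (d + δ) = d := div_mul_cancel₀ d hsum.ne'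
  have hc1 : c ≤ 1 := (div_le_one hsum).2 (by linarith)
  have scaled : ∀ z : E, ‖z‖ ≤ d + δ → ‖c • z‖ ≤ d ∧ ‖z - c • z‖ ≤ δ := fun z hz => by
    constructor
    · rw [norm_smul, Real.norm_of_nonneg hc0]
      exact (mul_le_mul_of_nonneg_left hz hc0).trans hcd.le
    · rw [show z - c • z = (1 - c) • z by rw [sub_smul, one_smul], norm_smul,
        Real.norm_of_nonneg (by linarith)]
      calc (1 - c) * ‖z‖ ≤ (1 - c) * (d + δ) := mul_le_mul_of_nonneg_left hz (by linarith)
        _ = δ := by rw [sub_mul, hcd]; ring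
  obtain ⟨hx1, hx2⟩ := scaled x hx
  obtain ⟨hy1, hy2⟩ := scaled y hy
  have key : ‖c • x - c • y‖ < ε / 2 := by
    by_contra! hcon
    have h3 := h hx1 hy1 hcon
    have h4 : ‖x + y‖ ≤ ‖c • x + c • y‖ + (‖x - c • x‖ + ‖y - c • y‖) := by
      calc ‖x + y‖ = ‖(c • x + c • y) + ((x - c • x) + (y - c • y))‖ := by congr 1; abel
        _ ≤ _ := (norm_add_le _ _).trans (by gcongr; exact norm_add_le _ _)
    linarith
  calc ‖x - y‖ = ‖(c • x - c • y) + ((x - c • x) - (y - c • y))‖ := by congr 1; abel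
    _ ≤ ‖c • x - c • y‖ + (‖x - c • x‖ + ‖y - c • y‖) :=
        (norm_add_le _ _).trans (by gcongr; exact norm_sub_le _ _)
    _ < ε := by linarith

/-- A sequential form of uniform convexity. -/
theorem tendsto_norm_sub_zero {d : ℝ} (hd : 0 ≤ d) {x y : ℕ → E} {L : ℕ → ℝ}
    (hx : Tendsto (fun n => ‖x n‖) atTop (𝓝 d)) (hy : Tendsto (fun n => ‖y n‖) atTop (𝓝 d))
    (hL : Tendsto L atTop (𝓝 (2 * d))) (hxy : ∀ n, L n ≤ ‖x n + y n‖) :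
    Tendsto (fun n => ‖x n - y n‖) atTop (𝓝 0) := by
  refine tendsto_order.2 ⟨fun a ha => Eventually.of_forall fun n => ha.trans_le (norm_nonneg _),
    fun ε hε => ?_⟩
  obtain ⟨δ, hδ, h⟩ := exists_pos_norm_sub_lt (E := E) hd hε
  filter_upwards [hx.eventually_lt_const (show d < d + δ by linarith),
    hy.eventually_lt_const (show d < d + δ by linarith),
    hL.eventually_const_lt (show 2 * d - δ < 2 * d by linarith)] with n h1 h2 h3
  exact h _ _ h1.le h2.le (h3.le.trans (hxy n))

/-- A decreasing sequence of nonempty bounded closed convex sets in a uniformly convex Banach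
space has a common point. -/
theorem exists_mem_forall_of_antitone [CompleteSpace E] {C : ℕ → Set E} (hanti : Antitone C)
    (hne : ∀ n, (C n).Nonempty) (hcl : ∀ n, IsClosed (C n)) (hconv : ∀ n, Convex ℝ (C n))
    {R : ℝ} (hR : ∀ n, ∀ c ∈ C n, ‖c‖ ≤ R) : ∃ z, ∀ n, z ∈ C n := by
  -- The distances of the sets from the origin increase to some `d`; almost nearest points form a
  -- Cauchy sequence, since their midpoints cannot have norm much below `d`.
  set D : ℕ → ℝ := fun n => sInf (norm '' C n)
  have hbdd : ∀ n, BddBelow (norm '' C n) := fun n => ⟨0, by rintro _ ⟨c, -, rfl⟩; positivity⟩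
  have hDle : ∀ n, ∀ c ∈ C n, D n ≤ ‖c‖ := fun n c hc => csInf_le (hbdd n) ⟨c, hc, rfl⟩
  have hD0 : ∀ n, 0 ≤ D n := fun n => Real.sInf_nonneg (by rintro _ ⟨c, -, rfl⟩; positivity)
  have hDmono : Monotone D := fun m n hmn =>
    csInf_le_csInf (hbdd m) ((hne n).image _) (Set.image_mono (hanti hmn))
  have hDR : BddAbove (Set.range D) := ⟨R, by
    rintro _ ⟨n, rfl⟩
    obtain ⟨c, hc⟩ := hne n
    exact (hDle n c hc).trans (hR n c hc)⟩
  obtain ⟨d, hd⟩ : ∃ d, Tendsto D atTop (𝓝 d) := ⟨_, tendsto_atTop_ciSup hDmono hDR⟩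
  have hd0 : 0 ≤ d := ge_of_tendsto' hd hD0
  have hpt : ∀ n, ∃ c ∈ C n, ‖c‖ < D n + 1 / ((n : ℝ) + 1) := fun n => by
    obtain ⟨_, ⟨c, hc, rfl⟩, hlt⟩ :=
      exists_lt_of_csInf_lt ((hne n).image norm) (lt_add_of_pos_right (D n) Nat.one_div_pos_of_nat)
    exact ⟨c, hc, hlt⟩
  choose c hcC hclt using hpt
  have hcd : Tendsto (fun n => ‖c n‖) atTop (𝓝 d) :=
    tendsto_of_tendsto_of_tendsto_of_le_of_le hd
      (by simpa using hd.add tendsto_one_div_add_atTop_nhds_zero_nat)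
      (fun n => hDle n _ (hcC n)) (fun n => (hclt n).le)
  have hcauchy : CauchySeq c := by
    refine Metric.cauchySeq_iff'.2 fun ε hε => ?_
    obtain ⟨δ, hδ, h⟩ := exists_pos_norm_sub_lt (E := E) hd0 hε
    obtain ⟨M, hM⟩ := eventually_atTop.1
      ((hcd.eventually_lt_const (show d < d + δ by linarith)).and
        (hd.eventually_const_lt (show d - δ / 2 < d by linarith)))
    refine ⟨M, fun n hn => ?_⟩
    rw [dist_eq_norm]
    refine h _ _ (hM n hn).1.le (hM M le_rfl).1.le ?_
    have hmid : (2⁻¹ : ℝ) • (c n + c M) ∈ C M := by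
      rw [smul_add]
      exact hconv M (hanti hn (hcC n)) (hcC M) (by norm_num) (by norm_num) (by norm_num)
    have h1 := hDle M _ hmid
    rw [norm_smul, Real.norm_of_nonneg (by norm_num)] at h1
    linarith [(hM M le_rfl).2]
  obtain ⟨z, hz⟩ := cauchySeq_tendsto_of_complete hcauchy
  exact ⟨z, fun n => (hcl n).mem_of_tendsto hz
    (eventually_atTop.2 ⟨n, fun m hm => hanti hm (hcC m)⟩)⟩

/-- A nonempty closed convex set in a uniformly convex Banach space has an element of minimal
norm. -/
theorem exists_norm_le_of_isClosed_convex [CompleteSpace E] {C : Set E} (hne : C.Nonempty)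
    (hcl : IsClosed C) (hconv : Convex ℝ C) : ∃ b ∈ C, ∀ c ∈ C, ‖b‖ ≤ ‖c‖ := by
  set d := sInf (norm '' C)
  have hbdd : BddBelow (norm '' C) := ⟨0, by rintro _ ⟨c, -, rfl⟩; positivity⟩
  obtain ⟨b, hb⟩ := exists_mem_forall_of_antitone
    (C := fun n : ℕ => C ∩ Metric.closedBall (0 : E) (d + 1 / ((n : ℝ) + 1)))
    (fun m n hmn => Set.inter_subset_inter_right _ (Metric.closedBall_subset_closedBall
      (by gcongr)))
    (fun n => by
      obtain ⟨_, ⟨c, hc, rfl⟩, hlt⟩ :=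
        exists_lt_of_csInf_lt (hne.image norm) (lt_add_of_pos_right d Nat.one_div_pos_of_nat)
      exact ⟨c, hc, mem_closedBall_zero_iff.2 hlt.le⟩)
    (fun n => hcl.inter Metric.isClosed_closedBall)
    (fun n => hconv.inter (convex_closedBall _ _))
    (R := d + 1)
    (fun n c hc => (mem_closedBall_zero_iff.1 hc.2).trans (by
      gcongr
      rw [div_le_one (by positivity)]
      linarith [n.cast_nonneg (α := ℝ)]))
  refine ⟨b, (hb 0).1, fun c hc => le_trans ?_ (csInf_le hbdd ⟨c, hc, rfl⟩)⟩
  exact ge_of_tendsto' (by simpa using tendsto_one_div_add_atTop_nhds_zero_nat.const_add d)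
    (fun n => mem_closedBall_zero_iff.1 (hb n).2)

/-- Every functional on a uniformly convex Banach space attains its norm on the unit ball. -/
theorem exists_norm_le_one_apply_eq_norm [CompleteSpace E] (u : StrongDual ℝ E) :
    ∃ e : E, ‖e‖ ≤ 1 ∧ u e = ‖u‖ := by
  obtain ⟨e, he⟩ := exists_mem_forall_of_antitone
    (C := fun n : ℕ => Metric.closedBall (0 : E) 1 ∩ {e | ‖u‖ - 1 / ((n : ℝ) + 1) ≤ u e})
    (fun m n hmn => Set.inter_subset_inter_right _
      (Set.ofPred_subset_ofPred.2 fun e he => le_trans (by gcongr) he))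
    (fun n => by
      obtain ⟨e, he1, he2⟩ := u.exists_lt_apply_of_lt_opNorm
        (sub_lt_self ‖u‖ (Nat.one_div_pos_of_nat (α := ℝ) (n := n)))
      rcases le_total 0 (u e) with h | h
      · rw [Real.norm_of_nonneg h] at he2
        exact ⟨e, mem_closedBall_zero_iff.2 he1.le, he2.le⟩
      · rw [Real.norm_of_nonpos h, ← map_neg] at he2
        exact ⟨-e, mem_closedBall_zero_iff.2 (by rw [norm_neg]; exact he1.le), he2.le⟩)
    (fun n => Metric.isClosed_closedBall.inter (isClosed_le continuous_const u.continuous))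
    (fun n => (convex_closedBall _ _).inter (convex_halfSpace_ge u.toLinearMap.isLinear _))
    (R := 1) (fun n c hc => mem_closedBall_zero_iff.1 hc.1)
  have he1 : ‖e‖ ≤ 1 := mem_closedBall_zero_iff.1 (he 0).1
  refine ⟨e, he1, le_antisymm ?_ ?_⟩
  · exact (le_abs_self _).trans ((u.le_opNorm e).trans (mul_le_of_le_one_right (norm_nonneg _) he1))
  · exact le_of_tendsto' (by simpa using tendsto_one_div_add_atTop_nhds_zero_nat.const_sub ‖u‖)
      (fun n => (he n).2)

end UniformConvexity

/-! ### Weak sequential compactness of bounded sets -/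

section WeakCompactness

variable {E : Type*} [NormedAddCommGroup E] [NormedSpace ℝ E]

theorem weaklyConverges_iff {u : ℕ → E} {a : E} :
    WeaklyConverges u a ↔ ∀ f : StrongDual ℝ E, Tendsto (fun n => f (u n)) atTop (𝓝 (f a)) := by
  unfold WeaklyConverges
  have hinj : Function.Injective (topDualPairing ℝ E).flip := fun a b hab => by
    by_contra hne
    obtain ⟨f, hf⟩ := SeparatingDual.exists_separating_of_ne (R := ℝ) hne
    exact hf (LinearMap.congr_fun hab f)
  exact WeakBilin.tendsto_iff_forall_eval_tendsto (topDualPairing ℝ E).flip hinj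

/-- On a separable set, countably many functionals separate a point from zero. -/
theorem exists_seq_dual_separating {S : Set E} (hS : TopologicalSpace.IsSeparable S) :
    ∃ f : ℕ → StrongDual ℝ E, ∀ z ∈ S, (∀ k, f k z = 0) → z = 0 := by
  obtain ⟨D, hD, hSD⟩ := hS
  have hD' : (insert (0 : E) D).Countable := hD.insert 0
  obtain ⟨e, he⟩ := hD'.exists_eq_range (Set.insert_nonempty _ _)
  choose f hf1 hf2 using fun k => exists_dual_vector'' ℝ (e k)
  refine ⟨f, fun z hz h0 => norm_le_zero_iff.1 (le_of_forall_pos_le_add fun ε hε => ?_)⟩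
  obtain ⟨b, hb, hzb⟩ := Metric.mem_closure_iff.1 (hSD hz) (ε / 2) (half_pos hε)
  obtain ⟨k, rfl⟩ : b ∈ Set.range e := he ▸ Set.mem_insert_of_mem _ hb
  -- The functional norming `e k` kills `z`, so `e k` is small when it is close to `z`.
  have h1 : ‖e k‖ ≤ ‖e k - z‖ := by
    calc ‖e k‖ = f k (e k - z) := by rw [map_sub, h0 k, sub_zero]; exact (hf2 k).symm
      _ ≤ ‖f k (e k - z)‖ := le_abs_self _
      _ ≤ 1 * ‖e k - z‖ := (f k).le_of_opNorm_le (hf1 k) _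
      _ = _ := one_mul _
  have h2 : ‖z‖ ≤ ‖e k‖ + ‖e k - z‖ := by
    calc ‖z‖ = ‖e k - (e k - z)‖ := by congr 1; abel
      _ ≤ _ := norm_sub_le _ _
  rw [dist_eq_norm, norm_sub_rev] at hzb
  linarith

/-- The closed convex hulls of the tails of a bounded sequence have a common point `z`, and
`f z = lim f (x n)` for all functionals `f` for which the limit exists. -/
theorem exists_tail_limit [CompleteSpace E] [UniformConvexSpace E] {x : ℕ → E} {R : ℝ}
    (hx : ∀ n, ‖x n‖ ≤ R) :
    ∃ z ∈ closedConvexHull ℝ (Set.range x), ∀ (f : StrongDual ℝ E) (a : ℝ),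
      Tendsto (fun n => f (x n)) atTop (𝓝 a) → f z = a := by
  obtain ⟨z, hz⟩ := exists_mem_forall_of_antitone
    (C := fun n => closedConvexHull ℝ (x '' Set.Ici n))
    (fun m n hmn => (closedConvexHull ℝ).monotone (Set.image_mono (Set.Ici_subset_Ici.2 hmn)))
    (fun n => ⟨x n, subset_closedConvexHull ⟨n, Set.self_mem_Ici, rfl⟩⟩)
    (fun n => isClosed_closedConvexHull) (fun n => convex_closedConvexHull)
    (R := R) (fun n c hc => by
      have : closedConvexHull ℝ (x '' Set.Ici n) ⊆ Metric.closedBall 0 R :=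
        closedConvexHull_min (by rintro _ ⟨m, -, rfl⟩; exact mem_closedBall_zero_iff.2 (hx m))
          (convex_closedBall _ _) Metric.isClosed_closedBall
      exact mem_closedBall_zero_iff.1 (this hc))
  refine ⟨z, (closedConvexHull ℝ).monotone (Set.image_subset_range _ _) (hz 0),
    fun f a hfa => ?_⟩
  refine eq_of_forall_dist_le fun ε hε => ?_
  obtain ⟨M, hM⟩ := Metric.tendsto_atTop.1 hfa ε hε
  have : closedConvexHull ℝ (x '' Set.Ici M) ⊆ f ⁻¹' Metric.closedBall a ε :=
    closedConvexHull_min (by rintro _ ⟨m, hm, rfl⟩; exact (hM m hm).le)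
      ((convex_closedBall a ε).linear_preimage f.toLinearMap)
      (Metric.isClosed_closedBall.preimage f.continuous)
  exact this (hz M)

/-- Bounded sequences in uniformly convex Banach spaces have weakly convergent subsequences. -/
theorem exists_subseq_weaklyConverges [CompleteSpace E] [UniformConvexSpace E] {x : ℕ → E} {R : ℝ}
    (hx : ∀ n, ‖x n‖ ≤ R) :
    ∃ (z : E) (φ : ℕ → ℕ), StrictMono φ ∧ WeaklyConverges (x ∘ φ) z := by
  set S : Submodule ℝ E := (Submodule.span ℝ (Set.range x)).topologicalClosure
  have hSsep : TopologicalSpace.IsSeparable (S : Set E) := by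
    rw [Submodule.topologicalClosure_coe]
    exact ((Set.countable_range x).isSeparable.span (R := ℝ)).closure
  have hull : ∀ φ : ℕ → ℕ, closedConvexHull ℝ (Set.range (x ∘ φ)) ⊆ (S : Set E) := fun φ =>
    closedConvexHull_min
      (by
        rintro _ ⟨n, rfl⟩
        exact Submodule.le_topologicalClosure _ (Submodule.subset_span ⟨φ n, rfl⟩))
      S.convex (Submodule.isClosed_topologicalClosure _)
  obtain ⟨f, hf⟩ := exists_seq_dual_separating hSsep
  have hbound : ∀ (g : StrongDual ℝ E) n, g (x n) ∈ Metric.closedBall (0 : ℝ) (‖g‖ * R) :=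
    fun g n => mem_closedBall_zero_iff.2 (g.le_opNorm_of_le (hx n))
  -- Compactness of the countable product replaces a diagonal argument: all `f k` converge along one
  -- `φ`.
  obtain ⟨a, -, φ, hφ, ha⟩ := (isCompact_univ_pi fun k =>
    isCompact_closedBall (0 : ℝ) (‖f k‖ * R)).tendsto_subseq
      (x := fun n k => f k (x n)) (fun n k _ => hbound (f k) n)
  rw [tendsto_pi_nhds] at ha
  obtain ⟨z, hzS, hz⟩ := exists_tail_limit (x := x ∘ φ) (fun n => hx (φ n))
  refine ⟨z, φ, hφ, weaklyConverges_iff.2 fun g => tendsto_of_subseq_tendsto fun ψ hψ => ?_⟩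
  -- For arbitrary `g`, a further subsequence on which `g` converges has its own tail limit `z'`;
  -- all `f k` agree on `z'` and `z`, so `z' = z`.
  obtain ⟨b, -, χ, hχ, hb⟩ := (isCompact_closedBall (0 : ℝ) (‖g‖ * R)).tendsto_subseq
    (x := fun n => g (x (φ (ψ n)))) (fun n => hbound g _)
  obtain ⟨z', hzS', hz'⟩ := exists_tail_limit (x := x ∘ (φ ∘ ψ ∘ χ)) (fun n => hx _)
  have hzz : z' - z = 0 := by
    refine hf _ (S.sub_mem (hull _ hzS') (hull _ hzS)) fun k => ?_
    rw [map_sub, hz (f k) (a k) (ha k),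
      hz' (f k) (a k) ((ha k).comp (hψ.comp hχ.tendsto_atTop)), sub_self]
  refine ⟨χ, ?_⟩
  have hgz : g z = b := by rw [← sub_eq_zero.1 hzz]; exact hz' g b hb
  rw [hgz]
  exact hb

end WeakCompactness

/-! ### Duality mappings and uniform smoothness of the dual norm -/

section DualityMapping

variable {E : Type*} [NormedAddCommGroup E] [NormedSpace ℝ E] {p q : ℝ}

/-- Rescales to the normalization in `IsSmooth`, so that its uniqueness clause applies. -/
theorem apply_eq_of_mem_dualityMapping_smul {x : E} {f : StrongDual ℝ E}
    (hf : f ∈ dualityMapping p x) (hx : x ≠ 0) :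
    ‖(‖x‖ ^ (p - 1))⁻¹ • f‖ = 1 ∧ ((‖x‖ ^ (p - 1))⁻¹ • f) x = ‖x‖ := by
  have hx' : 0 < ‖x‖ := norm_pos_iff.2 hx
  have hpow : 0 < ‖x‖ ^ (p - 1) := Real.rpow_pos_of_pos hx' _
  constructor
  · rw [norm_smul, hf.2, norm_inv, Real.norm_of_nonneg hpow.le, inv_mul_cancel₀ hpow.ne']
  · rw [smul_apply, hf.1, smul_eq_mul, Real.rpow_sub hx', Real.rpow_one]
    field_simp

/-- On a smooth space the duality mapping is single-valued. -/
theorem IsSmooth.eq_dualityMap (hE : IsSmooth E) (hp : 1 < p) {x : E} {f : StrongDual ℝ E}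
    (hf : f ∈ dualityMapping p x) : f = dualityMap p x := by
  have hg := dualityMap_mem hp x
  by_cases hx : x = 0
  · have hz : ∀ h ∈ dualityMapping p x, h = 0 := fun h hh => by
      rw [← norm_eq_zero, hh.2, hx, norm_zero, Real.zero_rpow (by linarith)]
    rw [hz _ hf, hz _ hg]
  · have hpow : 0 < ‖x‖ ^ (p - 1) := Real.rpow_pos_of_pos (norm_pos_iff.2 hx) _
    exact smul_right_injective _ (inv_ne_zero hpow.ne')
      ((hE x hx).unique (apply_eq_of_mem_dualityMapping_smul hf hx)
        (apply_eq_of_mem_dualityMapping_smul hg hx))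

theorem norm_rpow_of_mem_dualityMapping (hpq : p.HolderConjugate q) {x : E} {u : StrongDual ℝ E}
    (hu : u ∈ dualityMapping p x) : ‖u‖ ^ q = ‖x‖ ^ p := by
  rw [hu.2, ← Real.rpow_mul (norm_nonneg x), hpq.sub_one_mul_conj]

theorem norm_eq_of_mem_dualityMapping (hpq : p.HolderConjugate q) {x : E} {u : StrongDual ℝ E}
    (hu : u ∈ dualityMapping p x) : ‖x‖ = ‖u‖ ^ (q - 1) := by
  have h : (p - 1) * (q - 1) = 1 := by
    have := hpq.sub_one_mul_conj
    linarith
  rw [hu.2, ← Real.rpow_mul (norm_nonneg x), h, Real.rpow_one]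

/-- The duality mapping of the dual space inverts the duality mapping. -/
theorem mem_dualityMapping_of_inclusion_mem (hpq : p.HolderConjugate q) {x : E}
    {u : StrongDual ℝ E} (hx : NormedSpace.inclusionInDoubleDual ℝ E x ∈ dualityMapping q u) :
    u ∈ dualityMapping p x := by
  obtain ⟨h1, h2⟩ := hx
  rw [NormedSpace.dual_def] at h1
  have h2' : ‖x‖ = ‖u‖ ^ (q - 1) := by
    rw [← h2]
    exact ((NormedSpace.inclusionInDoubleDualLi ℝ).norm_map x).symm
  constructor
  · rw [h1, h2', ← Real.rpow_mul (norm_nonneg u), hpq.symm.sub_one_mul_conj]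
  · have h : (q - 1) * (p - 1) = 1 := by
      have := hpq.symm.sub_one_mul_conj
      linarith
    rw [h2', ← Real.rpow_mul (norm_nonneg u), h, Real.rpow_one]

/-- The duality mapping of a uniformly convex Banach space is surjective. -/
theorem exists_mem_dualityMapping [CompleteSpace E] [UniformConvexSpace E]
    (hpq : p.HolderConjugate q) (u : StrongDual ℝ E) : ∃ x, u ∈ dualityMapping p x := by
  by_cases hu : u = 0
  · refine ⟨0, ?_, ?_⟩
    · simp [Real.zero_rpow hpq.ne_zero]
    · simp [hu, Real.zero_rpow hpq.sub_one_ne_zero]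
  obtain ⟨e, he1, he⟩ := exists_norm_le_one_apply_eq_norm u
  have hu' : 0 < ‖u‖ := norm_pos_iff.2 hu
  have he1' : ‖e‖ = 1 := by
    refine le_antisymm he1 (le_of_mul_le_mul_left ?_ hu')
    rw [mul_one, ← he]
    exact (le_abs_self _).trans ((u.le_opNorm e).trans_eq (by rw [he]))
  refine ⟨‖u‖ ^ (q - 1) • e, mem_dualityMapping_of_inclusion_mem hpq ⟨?_, ?_⟩⟩
  · rw [NormedSpace.dual_def, map_smul, he, smul_eq_mul, Real.rpow_sub hu', Real.rpow_one]
    field_simp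
  · rw [show ‖NormedSpace.inclusionInDoubleDual ℝ E (‖u‖ ^ (q - 1) • e)‖ = ‖‖u‖ ^ (q - 1) • e‖ from
      (NormedSpace.inclusionInDoubleDualLi ℝ).norm_map _, norm_smul, he1', mul_one,
      Real.norm_of_nonneg (by positivity)]

/-- A point `x` with `u ∈ J x` is a subgradient at `u` of `‖·‖ ^ q / q`. -/
theorem rpow_norm_add_apply_le (hpq : p.HolderConjugate q) {x : E} {u : StrongDual ℝ E}
    (hu : u ∈ dualityMapping p x) (w : StrongDual ℝ E) :
    ‖u‖ ^ q / q + (w - u) x ≤ ‖w‖ ^ q / q := by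
  -- Young's inequality, which is an equality at `w = u`.
  have h1 : w x ≤ ‖w‖ ^ q / q + ‖x‖ ^ p / p :=
    ((le_abs_self _).trans (w.le_opNorm x)).trans
      (Real.young_inequality_of_nonneg (norm_nonneg _) (norm_nonneg _) hpq.symm)
  have h2 : ‖x‖ ^ p / p + ‖x‖ ^ p / q = ‖x‖ ^ p := by
    rw [div_eq_mul_inv, div_eq_mul_inv, ← mul_add, hpq.inv_add_inv_eq_one, mul_one]
  rw [sub_apply, hu.1, norm_rpow_of_mem_dualityMapping hpq hu]
  linarith

variable [UniformConvexSpace E]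

/-- Testing `x n + x' n` with `u n`, which is close to `u' n`, gives almost `‖x n‖ ^ p + ‖x' n‖ ^
p`. So the sum has norm almost `2 * d`, and uniform convexity applies. Dividing by `‖u n‖` in the
limit requires `d ≠ 0`, hence the case split. -/
theorem tendsto_norm_sub_of_dualityMapping_of_tendsto (hpq : p.HolderConjugate q) {d : ℝ}
    (hd : 0 ≤ d) {x x' : ℕ → E} {u u' : ℕ → StrongDual ℝ E}
    (hu : ∀ n, u n ∈ dualityMapping p (x n)) (hu' : ∀ n, u' n ∈ dualityMapping p (x' n))
    (hx : Tendsto (fun n => ‖x n‖) atTop (𝓝 d))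
    (h : Tendsto (fun n => ‖u n - u' n‖) atTop (𝓝 0)) :
    Tendsto (fun n => ‖x n - x' n‖) atTop (𝓝 0) := by
  have hun : Tendsto (fun n => ‖u n‖) atTop (𝓝 (d ^ (p - 1))) := by
    simp only [(hu _).2]
    exact hx.rpow_const (Or.inr hpq.sub_one_pos.le)
  have hun' : Tendsto (fun n => ‖u' n‖) atTop (𝓝 (d ^ (p - 1))) := by
    refine tendsto_of_tendsto_of_tendsto_of_le_of_le (by simpa using hun.sub h)
      (by simpa using hun.add h) (fun n => ?_) (fun n => ?_)
    · have := norm_sub_norm_le (u n) (u' n)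
      dsimp only
      linarith
    · have := norm_sub_norm_le (u' n) (u n)
      rw [norm_sub_rev] at this
      dsimp only
      linarith
  have hx' : Tendsto (fun n => ‖x' n‖) atTop (𝓝 d) := by
    simp only [norm_eq_of_mem_dualityMapping hpq (hu' _)]
    have h1 : (p - 1) * (q - 1) = 1 := by
      have := hpq.sub_one_mul_conj
      linarith
    have := hun'.rpow_const (p := q - 1) (Or.inr hpq.symm.sub_one_pos.le)
    rwa [← Real.rpow_mul hd, h1, Real.rpow_one] at this
  rcases hd.eq_or_lt with rfl | hd0
  · exact squeeze_zero (fun n => norm_nonneg _) (fun n => norm_sub_le _ _)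
      (by simpa using hx.add hx')
  · refine tendsto_norm_sub_zero hd hx hx'
      (L := fun n => (‖x n‖ ^ p + ‖x' n‖ ^ p - ‖u n - u' n‖ * ‖x' n‖) / ‖u n‖) ?_ (fun n => ?_)
    · have hlim := (((hx.rpow_const (p := p) (Or.inr hpq.nonneg)).add
        (hx'.rpow_const (p := p) (Or.inr hpq.nonneg))).sub (h.mul hx')).div hun
        (Real.rpow_pos_of_pos hd0 _).ne'
      suffices heq : 2 * d = (d ^ p + d ^ p - 0 * d) / d ^ (p - 1) by
        rw [heq]
        exact hlim
      rw [Real.rpow_sub hd0, Real.rpow_one]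
      have : d ^ p ≠ 0 := (Real.rpow_pos_of_pos hd0 _).ne'
      field_simp
      ring
    · refine div_le_of_le_mul₀ (norm_nonneg _) (norm_nonneg _) ?_
      have h1 : u n (x n + x' n) ≤ ‖u n‖ * ‖x n + x' n‖ :=
        (le_abs_self _).trans ((u n).le_opNorm _)
      have h2 : -(‖u n - u' n‖ * ‖x' n‖) ≤ (u n - u' n) (x' n) :=
        neg_le_of_abs_le ((u n - u' n).le_opNorm _)
      rw [map_add, (hu n).1] at h1
      rw [sub_apply, (hu' n).1] at h2
      linarith

/-- The inverse of the duality mapping is sequentially uniformly continuous on bounded sets. -/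
theorem tendsto_norm_sub_of_dualityMapping (hpq : p.HolderConjugate q) {R : ℝ} {x x' : ℕ → E}
    {u u' : ℕ → StrongDual ℝ E} (hu : ∀ n, u n ∈ dualityMapping p (x n))
    (hu' : ∀ n, u' n ∈ dualityMapping p (x' n)) (hx : ∀ n, ‖x n‖ ≤ R)
    (h : Tendsto (fun n => ‖u n - u' n‖) atTop (𝓝 0)) :
    Tendsto (fun n => ‖x n - x' n‖) atTop (𝓝 0) := by
  refine tendsto_of_subseq_tendsto fun ψ hψ => ?_
  obtain ⟨d, hd, χ, hχ, hxd⟩ := (isCompact_Icc (a := 0) (b := R)).tendsto_subseq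
    (x := fun n => ‖x (ψ n)‖) (fun n => ⟨norm_nonneg _, hx _⟩)
  exact ⟨χ, tendsto_norm_sub_of_dualityMapping_of_tendsto hpq hd.1 (fun n => hu _)
    (fun n => hu' _) hxd (h.comp (hψ.comp hχ.tendsto_atTop))⟩

/-- The inverse of the duality mapping is uniformly continuous on bounded sets. -/
theorem exists_pos_norm_sub_le_of_dualityMapping (hpq : p.HolderConjugate q) (R : ℝ) {η : ℝ}
    (hη : 0 < η) :
    ∃ δ > 0, ∀ (x x' : E) (u u' : StrongDual ℝ E), u ∈ dualityMapping p x →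
      u' ∈ dualityMapping p x' → ‖x‖ ≤ R → ‖u - u'‖ ≤ δ → ‖x - x'‖ ≤ η := by
  by_contra! hcon
  choose x x' u u' hu hu' hx h hlt using fun n : ℕ => hcon _ (Nat.one_div_pos_of_nat (n := n))
  have h0 := tendsto_norm_sub_of_dualityMapping hpq hu hu' hx
    (squeeze_zero (fun n => norm_nonneg _) h tendsto_one_div_add_atTop_nhds_zero_nat)
  exact (ge_of_tendsto' h0 fun n => (hlt n).le).not_gt hη

/-- The function `‖·‖ ^ q / q` on the dual of a uniformly convex Banach space is uniformly smooth
on bounded sets. -/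
theorem exists_pos_rpow_norm_add_le [CompleteSpace E] (hpq : p.HolderConjugate q) (R : ℝ) {η : ℝ}
    (hη : 0 < η) :
    ∃ δ > 0, ∀ (x : E) (u h : StrongDual ℝ E), u ∈ dualityMapping p x → ‖x‖ ≤ R → ‖h‖ ≤ δ →
      ‖u + h‖ ^ q / q ≤ ‖u‖ ^ q / q + h x + η * ‖h‖ := by
  obtain ⟨δ, hδ, hJ⟩ := exists_pos_norm_sub_le_of_dualityMapping (E := E) hpq R hη
  refine ⟨δ, hδ, fun x u h hu hx hh => ?_⟩
  -- The subgradient inequality at `u + h`, tested at `u`, bounds the increment by `h x'`; replacing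
  -- `x'` by `x` costs at most `η * ‖h‖`.
  obtain ⟨x', hx'⟩ := exists_mem_dualityMapping hpq (u + h)
  have h1 := rpow_norm_add_apply_le hpq hx' u
  have h2 := hJ x x' u (u + h) hu hx' hx (by rw [sub_add_cancel_left, norm_neg]; exact hh)
  have h3 : h (x' - x) ≤ ‖h‖ * η :=
    (le_abs_self _).trans (h.le_opNorm_of_le (by rw [norm_sub_rev]; exact h2))
  rw [sub_add_cancel_left, neg_apply] at h1
  rw [map_sub] at h3
  linarith

/-- If `τ ↦ ‖u + τ • v‖ ^ q / q + τ * b` is minimal at `τ = 0`, then its derivative vanishes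
there. -/
theorem apply_add_eq_zero_of_forall_le [CompleteSpace E] (hpq : p.HolderConjugate q) {x : E}
    {u v : StrongDual ℝ E} (hu : u ∈ dualityMapping p x) {b : ℝ}
    (hmin : ∀ τ : ℝ, ‖u‖ ^ q / q ≤ ‖u + τ • v‖ ^ q / q + τ * b) : v x + b = 0 := by
  refine abs_nonpos_iff.1 (le_of_forall_pos_le_add fun ε hε => ?_)
  obtain ⟨δ, hδ, h⟩ := exists_pos_rpow_norm_add_le (E := E) hpq ‖x‖
    (show 0 < ε / (‖v‖ + 1) by positivity)
  set τ := δ / (‖v‖ + 1)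
  have hτ : 0 < τ := by positivity
  -- Minimality plus first-order expansion; the signs `σ = ±τ` bound `v x + b` from both sides.
  have key : ∀ σ : ℝ, |σ| = τ → 0 ≤ σ * (v x + b) + τ * ε := fun σ hσ => by
    have hnorm : ‖σ • v‖ = τ * ‖v‖ := by rw [norm_smul, Real.norm_eq_abs, hσ]
    have h1 := h x u (σ • v) hu le_rfl (by
      rw [hnorm, div_mul_eq_mul_div, div_le_iff₀ (by positivity)]
      gcongr
      linarith)
    have h2 := hmin σ
    have h3 : ε / (‖v‖ + 1) * (τ * ‖v‖) ≤ τ * ε := by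
      rw [div_mul_eq_mul_div, div_le_iff₀ (by positivity)]
      nlinarith [mul_pos hε hτ]
    rw [hnorm, smul_apply, smul_eq_mul] at h1
    linarith
  have k1 := key τ (abs_of_pos hτ)
  have k2 := key (-τ) (by rw [abs_neg, abs_of_pos hτ])
  rw [zero_add, abs_le]
  constructor <;> refine le_of_mul_le_mul_left ?_ hτ <;> linarith

end DualityMapping

variable {X : Type*} [NormedAddCommGroup X] [NormedSpace ℝ X]
variable {Y : Type*} [NormedAddCommGroup Y] [NormedSpace ℝ Y]
variable {p q r : ℝ} {A : X →L[ℝ] Y} {y : Y}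

/-! ### Minimal-norm solution and Bregman projection -/

section SolutionSet

@[simp]
theorem dualOp_apply (A : X →L[ℝ] Y) (f : StrongDual ℝ Y) (z : X) : dualOp A f z = f (A z) := rfl

theorem closure_range_dualOp (A : X →L[ℝ] Y) :
    closure (Set.range (dualOp A)) =
      ((LinearMap.range (dualOp A).toLinearMap).topologicalClosure : Set (StrongDual ℝ X)) := by
  rw [Submodule.topologicalClosure_coe]
  rfl

/-- Functionals in the closure of the range of `A*` are constant on the fibres of `A`. -/
theorem apply_eq_of_mem_closure_range_dualOp {f : StrongDual ℝ X}
    (hf : f ∈ closure (Set.range (dualOp A))) {z z' : X} (hz : A z = A z') : f z = f z' := by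
  have hcl : IsClosed {g : StrongDual ℝ X | g z = g z'} :=
    isClosed_eq (ContinuousLinearMap.apply ℝ ℝ z).continuous
      (ContinuousLinearMap.apply ℝ ℝ z').continuous
  exact closure_minimal (by rintro _ ⟨g, rfl⟩; simp [hz]) hcl hf

/-- A solution whose image under the duality mapping lies in the closure of the range of `A*` has
minimal norm. -/
theorem norm_le_of_dualityMap_mem_closure (hp : 1 < p) {b : X}
    (hb : dualityMap p b ∈ closure (Set.range (dualOp A))) {z : X} (hz : A z = A b) :
    ‖b‖ ≤ ‖z‖ := by
  rcases (norm_nonneg b).eq_or_lt with h0 | h0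
  · rw [← h0]
    exact norm_nonneg z
  have hJ := dualityMap_mem hp b
  have h1 : ‖b‖ ^ p ≤ ‖b‖ ^ (p - 1) * ‖z‖ := by
    rw [← hJ.1, ← apply_eq_of_mem_closure_range_dualOp hb hz, ← hJ.2]
    exact (le_abs_self _).trans ((dualityMap p b).le_opNorm z)
  rw [Real.rpow_sub h0, Real.rpow_one, div_mul_eq_mul_div, le_div_iff₀ h0] at h1
  exact le_of_mul_le_mul_left h1 (Real.rpow_pos_of_pos h0 p)

/-- The solution of minimal norm. -/
theorem exists_solution_norm_lt [CompleteSpace X] [UniformConvexSpace X]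
    (hy : y ∈ Set.range A) :
    ∃ b ∈ solutionSet A y, ∀ z ∈ solutionSet A y, z ≠ b → ‖b‖ < ‖z‖ := by
  have hconv : Convex ℝ (solutionSet A y) :=
    (convex_singleton y).linear_preimage A.toLinearMap
  obtain ⟨b, hb, hmin⟩ := exists_norm_le_of_isClosed_convex (C := solutionSet A y) hy
    (isClosed_eq A.continuous continuous_const) hconv
  refine ⟨b, hb, fun z hz hne => ?_⟩
  by_contra! hle
  have h1 := norm_combo_lt_of_ne hle le_rfl hne (half_pos one_pos) (half_pos one_pos)
    (add_halves (1 : ℝ))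
  exact h1.not_ge (hmin _ (hconv hz hb (by norm_num) (by norm_num) (by norm_num)))

/-- If `J x₀` lies in the closure of the range of `A*`, then the solution of minimal norm is the
Bregman projection of `x₀`. -/
theorem isBregmanProjection_of_norm_lt (hp : 0 < p) {x₀ b : X}
    (hx₀ : dualityMap p x₀ ∈ closure (Set.range (dualOp A))) (hb : b ∈ solutionSet A y)
    (hmin : ∀ z ∈ solutionSet A y, z ≠ b → ‖b‖ < ‖z‖) :
    IsBregmanProjection p (solutionSet A y) x₀ b := by
  refine ⟨hb, fun z hz hne => ?_⟩
  have h1 : dualityMap p x₀ b = dualityMap p x₀ z :=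
    apply_eq_of_mem_closure_range_dualOp hx₀ ((show A b = y from hb).trans (Eq.symm hz))
  have h2 := Real.rpow_lt_rpow (norm_nonneg b) (hmin z hz hne) hp
  unfold bregmanDistance
  rw [map_sub, map_sub, h1]
  gcongr

end SolutionSet

/-! ### Invariants and optimality conditions of a run -/

section Run

variable {jY : Y → StrongDual ℝ Y} {N : ℕ → ℕ} {x : ℕ → X} {o : ℕ → StrongDual ℝ Y}
  {s t : ℕ → ℕ → ℝ} {n : ℕ}

theorem mem_window (hN : 1 ≤ N n) : n ∈ window N n := by
  rw [window, Finset.mem_Icc]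
  omega

theorem sum_add_single_smul {M : Type*} [AddCommGroup M] [Module ℝ M] {W : Finset ℕ} {m : ℕ}
    (hm : m ∈ W) (τ : ℕ → ℝ) (c : ℝ) (v : ℕ → M) :
    ∑ k ∈ W, (τ k + if k = m then c else 0) • v k = ∑ k ∈ W, τ k • v k + c • v m := by
  simp [add_smul, Finset.sum_add_distrib, ite_smul, hm]

/-- The effect of changing a single coordinate in the line search functional. -/
theorem lineSearch_add_single {W : Finset ℕ} {m : ℕ} (hm : m ∈ W) (z : X) (τ : ℕ → ℝ) (c : ℝ) :
    lineSearch p q A y o W z (fun k => τ k + if k = m then c else 0) =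
      ‖dualityMap p z - ∑ k ∈ W, τ k • dualOp A (o k) + c • -dualOp A (o m)‖ ^ q / q +
        c * o m y + ∑ k ∈ W, τ k * o k y := by
  have h := sum_add_single_smul hm τ c (fun k => o k y)
  simp only [smul_eq_mul] at h
  unfold lineSearch
  rw [h, sum_add_single_smul hm τ c (fun k => dualOp A (o k)), smul_neg, ← sub_eq_add_neg,
    ← sub_sub]
  ring

/-- `J_q*` is inverted by `J_p`, so the update becomes linear in the dual space. -/
theorem IsRun.dualityMap_succ (hX : IsSmooth X) (hpq : p.HolderConjugate q)
    (hrun : IsRun p q A y jY N x o s t) (hn : ∀ m ≤ n, A (x m) ≠ y) :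
    dualityMap p (x (n + 1)) =
      dualityMap p (x n) - ∑ m ∈ window N n, t n m • dualOp A (o m) :=
  (hX.eq_dualityMap hpq.lt (mem_dualityMapping_of_inclusion_mem hpq (hrun.update n hn))).symm

/-- Only earlier iterates must be non-solutions, so the iterate at which the method stops is
covered. -/
theorem IsRun.dualityMap_mem_closure (hX : IsSmooth X) (hpq : p.HolderConjugate q)
    (hrun : IsRun p q A y jY N x o s t) (n : ℕ) (hn : ∀ m < n, A (x m) ≠ y) :
    dualityMap p (x n) ∈ closure (Set.range (dualOp A)) := by
  induction n with
  | zero => exact hrun.initial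
  | succ n ih =>
    rw [hrun.dualityMap_succ hX hpq fun m hm => hn m (Nat.lt_succ_of_le hm)]
    have h := ih fun m hm => hn m (hm.trans n.lt_succ_self)
    rw [closure_range_dualOp] at h ⊢
    exact Submodule.sub_mem _ h (Submodule.sum_mem _ fun m _ => Submodule.smul_mem _ _
      (Submodule.le_topologicalClosure _ ⟨o m, rfl⟩))

/-- Optimality of the step widths. -/
theorem IsRun.apply_residual_eq_zero [CompleteSpace X] [UniformConvexSpace X] (hX : IsSmooth X)
    (hpq : p.HolderConjugate q) (hrun : IsRun p q A y jY N x o s t)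
    (hn : ∀ m ≤ n, A (x m) ≠ y) {m : ℕ} (hm : m ∈ window N n) :
    o m (A (x (n + 1)) - y) = 0 := by
  have h := apply_add_eq_zero_of_forall_le hpq (dualityMap_mem hpq.lt (x (n + 1)))
    (v := -dualOp A (o m)) (b := o m y) fun c => by
      have h1 := hrun.stepwidth n hn (fun k => t n k + if k = m then c else 0)
      rw [lineSearch_add_single hm, lineSearch, ← hrun.dualityMap_succ hX hpq hn] at h1
      linarith
  rw [neg_apply, dualOp_apply] at h
  rw [map_sub]
  linarith

/-- The new search direction sees the full residual. -/
theorem IsRun.apply_residual [CompleteSpace X] [UniformConvexSpace X] (hX : IsSmooth X)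
    (hpq : p.HolderConjugate q) (hjY : ∀ w, jY w ∈ dualityMapping r w)
    (hrun : IsRun p q A y jY N x o s t) (hn : ∀ m ≤ n, A (x m) ≠ y) :
    o n (A (x n) - y) = ‖A (x n) - y‖ ^ r := by
  -- The directions projected out are exactly those over which `x n` was optimized.
  have h0 : ∀ m ∈ prevWindow N n, o m (A (x n) - y) = 0 := by
    cases n with
    | zero => simp [prevWindow]
    | succ k =>
      exact fun m hm =>
        hrun.apply_residual_eq_zero hX hpq (fun i hi => hn i (hi.trans k.le_succ)) hm
  rw [hrun.direction n hn, sub_apply, (hjY _).1, sum_apply,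
    Finset.sum_eq_zero fun m hm => by rw [smul_apply, h0 m hm, smul_zero], sub_zero]

/-- The semi-orthogonalized search direction is not longer than the Landweber direction. -/
theorem IsRun.norm_direction_le (hrun : IsRun p q A y jY N x o s t)
    (hn : ∀ m ≤ n, A (x m) ≠ y) :
    ‖dualOp A (o n)‖ ≤ ‖dualOp A (jY (A (x n) - y))‖ := by
  have h := (hrun.projection n hn).2 0 (Submodule.zero_mem _)
  rw [sub_zero] at h
  refine le_trans (le_of_eq ?_) h
  rw [hrun.direction n hn, map_sub, map_sum]
  simp only [map_smul]

/-! ### Descent, boundedness and vanishing residuals -/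

/-- Up to a constant, the Bregman distance of `x` to `z`, expressed through `J x`. -/
def dualDistance (p q : ℝ) (z x : X) : ℝ :=
  ‖dualityMap p x‖ ^ q / q - dualityMap p x z

theorem neg_le_dualDistance (hpq : p.HolderConjugate q) (z x : X) :
    -(‖z‖ ^ p / p) ≤ dualDistance p q z x := by
  have h1 : dualityMap p x z ≤ ‖dualityMap p x‖ ^ q / q + ‖z‖ ^ p / p :=
    ((le_abs_self _).trans ((dualityMap p x).le_opNorm z)).trans
      (Real.young_inequality_of_nonneg (norm_nonneg _) (norm_nonneg _) hpq.symm)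
  unfold dualDistance
  linarith

/-- The dual distance is coercive. -/
theorem norm_le_of_dualDistance_le (hpq : p.HolderConjugate q) {z x : X} {c : ℝ}
    (h : dualDistance p q z x ≤ c) : ‖x‖ ≤ max (q * (‖z‖ + 1)) (c ^ (q - 1)) := by
  by_contra! hcon
  obtain ⟨h1, h2⟩ := max_lt_iff.1 hcon
  have hJ := dualityMap_mem hpq.lt x
  have hx : 0 < ‖x‖ := lt_of_le_of_lt (by have := hpq.symm.nonneg; positivity) h1
  have h3 : dualityMap p x z ≤ ‖x‖ ^ (p - 1) * ‖z‖ := by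
    rw [← hJ.2]
    exact (le_abs_self _).trans ((dualityMap p x).le_opNorm z)
  have h4 : ‖x‖ ^ p = ‖x‖ ^ (p - 1) * ‖x‖ := by
    rw [Real.rpow_sub hx, Real.rpow_one]
    field_simp
  unfold dualDistance at h
  rw [norm_rpow_of_mem_dualityMapping hpq hJ, h4] at h
  -- This makes the dual distance at least `‖J x‖`, hence `‖J x‖ ≤ c`, contradicting the second
  -- bound.
  have h5 : ‖z‖ + 1 ≤ ‖x‖ / q := by
    rw [le_div_iff₀ hpq.symm.pos, mul_comm]
    exact h1.le
  have h6 : ‖x‖ ^ (p - 1) * (‖z‖ + 1) ≤ ‖x‖ ^ (p - 1) * (‖x‖ / q) := by gcongr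
  rw [← mul_div_assoc] at h6
  have h7 : ‖dualityMap p x‖ ≤ c := by
    rw [hJ.2]
    linarith
  rw [norm_eq_of_mem_dualityMapping hpq hJ] at h2
  exact h2.not_ge (Real.rpow_le_rpow (norm_nonneg _) h7 hpq.symm.sub_one_pos.le)

/-- A step of the method is at least as good as any step along the newest search direction. -/
theorem IsRun.dualDistance_succ_le (hX : IsSmooth X) (hpq : p.HolderConjugate q)
    (hrun : IsRun p q A y jY N x o s t) (hn : ∀ m ≤ n, A (x m) ≠ y) (hN : 1 ≤ N n) {z : X}
    (hz : A z = y) (c : ℝ) :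
    dualDistance p q z (x (n + 1)) ≤
      ‖dualityMap p (x n) + c • -dualOp A (o n)‖ ^ q / q + c * o n y - dualityMap p (x n) z := by
  have h1 := hrun.stepwidth n hn (fun k => 0 + if k = n then c else 0)
  rw [lineSearch_add_single (mem_window hN) (x n) (fun _ => 0) c] at h1
  simp only [zero_smul, zero_mul, Finset.sum_const_zero, sub_zero, add_zero] at h1
  -- Since `A z = y`, the offsets are `⟨v_m, z⟩`, so the line search functional is the dual distance
  -- up to the constant `⟨J x_n, z⟩`.
  refine le_trans (le_of_eq ?_) (sub_le_sub_right h1 _)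
  unfold dualDistance lineSearch
  rw [hrun.dualityMap_succ hX hpq hn, sub_apply, sum_apply]
  simp only [smul_apply, dualOp_apply, hz, smul_eq_mul]
  ring

theorem IsRun.antitone_dualDistance (hX : IsSmooth X) (hpq : p.HolderConjugate q)
    (hrun : IsRun p q A y jY N x o s t) (hn : ∀ n, A (x n) ≠ y) (hN : ∀ n, 1 ≤ N n) {z : X}
    (hz : A z = y) : Antitone fun n => dualDistance p q z (x n) :=
  antitone_nat_of_succ_le fun n => by
    have h := hrun.dualDistance_succ_le hX hpq (fun m _ => hn m) (hN n) hz 0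
    rw [zero_smul, zero_mul, add_zero, add_zero] at h
    exact h

/-- The residuals tend to zero. -/
theorem IsRun.tendsto_residual [CompleteSpace X] [UniformConvexSpace X] (hX : IsSmooth X)
    (hpq : p.HolderConjugate q) (hr : 1 < r) (hjY : ∀ w, jY w ∈ dualityMapping r w)
    (hrun : IsRun p q A y jY N x o s t) (hn : ∀ n, A (x n) ≠ y) (hN : ∀ n, 1 ≤ N n) {z : X}
    (hz : A z = y) {R : ℝ} (hR : ∀ n, ‖x n‖ ≤ R) :
    Tendsto (fun n => ‖A (x n) - y‖) atTop (𝓝 0) := by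
  have hR0 : 0 ≤ R := (norm_nonneg _).trans (hR 0)
  set W := ‖A‖ * R + ‖y‖
  have hW : ∀ n, ‖A (x n) - y‖ ≤ W := fun n =>
    (norm_sub_le _ _).trans (add_le_add_left (A.le_opNorm_of_le (hR n)) _)
  have hW0 : 0 ≤ W := (norm_nonneg _).trans (hW 0)
  set K := ‖dualOp A‖ * W ^ (r - 1) + 1
  have hK0 : 0 < K := by positivity
  have hK : ∀ n, ‖dualOp A (o n)‖ ≤ K := fun n => by
    refine (hrun.norm_direction_le fun m _ => hn m).trans (((dualOp A).le_opNorm _).trans ?_)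
    rw [(hjY _).2]
    have := Real.rpow_le_rpow (norm_nonneg _) (hW n) (show 0 ≤ r - 1 by linarith)
    have h2 : ‖dualOp A‖ * ‖A (x n) - y‖ ^ (r - 1) ≤ ‖dualOp A‖ * W ^ (r - 1) := by gcongr
    linarith
  obtain ⟨L, hL⟩ : ∃ L, Tendsto (fun n => dualDistance p q z (x n)) atTop (𝓝 L) :=
    ⟨_, tendsto_atTop_ciInf (hrun.antitone_dualDistance hX hpq hn hN hz)
      ⟨_, by rintro _ ⟨n, rfl⟩; exact neg_le_dualDistance hpq z (x n)⟩⟩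
  have hdiff := hL.sub (hL.comp (tendsto_add_atTop_nat 1))
  rw [sub_self] at hdiff
  refine tendsto_order.2 ⟨fun a ha => Eventually.of_forall fun n => ha.trans_le (norm_nonneg _),
    fun ε hε => ?_⟩
  have hεr : 0 < ε ^ r := Real.rpow_pos_of_pos hε r
  -- With `τ = δ / K` the trial step has length at most `δ`, and this tolerance limits the
  -- smoothness error to half the gain `τ * ε ^ r`.
  obtain ⟨δ, hδ, h⟩ := exists_pos_rpow_norm_add_le (E := X) hpq R
    (show 0 < ε ^ r / (2 * K) by positivity)
  set τ := δ / K
  have hτ : 0 < τ := by positivity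
  filter_upwards [hdiff.eventually_lt_const (show 0 < τ * (ε ^ r / 2) by positivity)] with n hlt
  by_contra! hle
  have hnorm : ‖τ • -dualOp A (o n)‖ ≤ τ * K := by
    rw [norm_smul, norm_neg, Real.norm_of_nonneg hτ.le]
    gcongr
    exact hK n
  have h1 := hrun.dualDistance_succ_le hX hpq (fun m _ => hn m) (hN n) hz τ
  have h2 := h (x n) _ (τ • -dualOp A (o n)) (dualityMap_mem hpq.lt (x n)) (hR n)
    (hnorm.trans_eq (div_mul_cancel₀ δ hK0.ne'))
  have h3 : ε ^ r / (2 * K) * ‖τ • -dualOp A (o n)‖ ≤ τ * (ε ^ r / 2) := by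
    calc _ ≤ ε ^ r / (2 * K) * (τ * K) := by gcongr
      _ = _ := by field_simp
  have h4 := hrun.apply_residual hX hpq hjY (fun m _ => hn m) (n := n)
  have h5 : τ * ε ^ r ≤ τ * ‖A (x n) - y‖ ^ r := by gcongr
  rw [← h4, map_sub, mul_sub] at h5
  rw [smul_apply, neg_apply, dualOp_apply, smul_eq_mul] at h2
  simp only [Function.comp_apply] at hlt
  have h6 : dualDistance p q z (x n) =
    ‖dualityMap p (x n)‖ ^ q / q - dualityMap p (x n) z := rfl
  linarith

/-- A weak limit of iterates whose residuals tend to zero is a solution of minimal norm. -/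
theorem eq_of_weaklyConverges (hp : 1 < p) (hJ : DualityMapWeakContinuous p X)
    {b : X} (hb : b ∈ solutionSet A y) (hmin : ∀ z ∈ solutionSet A y, z ≠ b → ‖b‖ < ‖z‖)
    {u : ℕ → X} {a : X} (hu : WeaklyConverges u a)
    (hmem : ∀ n, dualityMap p (u n) ∈ closure (Set.range (dualOp A)))
    (hres : Tendsto (fun n => ‖A (u n) - y‖) atTop (𝓝 0)) : a = b := by
  have hAu : Tendsto (fun n => A (u n)) atTop (𝓝 y) := tendsto_iff_norm_sub_tendsto_zero.2 hres
  have hAa : A a = y := by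
    refine (SeparatingDual.eq_iff_forall_dual_eq (R := ℝ)).2 fun g => ?_
    exact tendsto_nhds_unique (weaklyConverges_iff.1 hu (dualOp A g))
      ((g.continuous.tendsto y).comp hAu)
  have hJa : dualityMap p a ∈ closure (Set.range (dualOp A)) := by
    rw [closure_range_dualOp] at hmem ⊢
    -- A closed subspace is weakly closed: a functional separating `J a` from it contradicts weak
    -- convergence.
    by_contra hnot
    obtain ⟨f, c, hf1, hf2⟩ := geometric_hahn_banach_closed_point
      (Submodule.convex _) (Submodule.isClosed_topologicalClosure _) hnot
    exact hf2.not_ge (le_of_tendsto' (weaklyConverges_iff.1 (hJ u a hu) f)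
      fun n => (hf1 _ (hmem n)).le)
  by_contra hne
  exact (hmin a hAa hne).not_ge
    (norm_le_of_dualityMap_mem_closure hp hJa ((show A b = y from hb).trans hAa.symm))

end Run

end Sesop

end

/-! ### Termination or weak convergence -/

theorem mainTheorem1
    {X : Type*} [NormedAddCommGroup X] [NormedSpace ℝ X] [CompleteSpace X] [UniformConvexSpace X]
    {Y : Type*} [NormedAddCommGroup Y] [NormedSpace ℝ Y] [CompleteSpace Y]
    (hX : Sesop.IsSmooth X)
    (p q r : ℝ) (hpq : p.HolderConjugate q) (hr : 1 < r)
    (hJ : Sesop.DualityMapWeakContinuous p X)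
    (A : X →L[ℝ] Y) (y : Y) (hy : y ∈ Set.range A)
    (jY : Y → StrongDual ℝ Y) (hjY : ∀ w, jY w ∈ Sesop.dualityMapping r w)
    (N : ℕ → ℕ) (hN : ∀ n, 1 ≤ N n ∧ N n ≤ n + 1)
    (x : ℕ → X) (o : ℕ → StrongDual ℝ Y) (s t : ℕ → ℕ → ℝ)
    (hrun : Sesop.IsRun p q A y jY N x o s t) :
    ∃ xdag : X,
      Sesop.IsBregmanProjection p (Sesop.solutionSet A y) (x 0) xdag ∧
      (∀ z ∈ Sesop.solutionSet A y, z ≠ xdag → ‖xdag‖ < ‖z‖) ∧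
      ((∃ n, (∀ m < n, A (x m) ≠ y) ∧ A (x n) = y ∧ x n = xdag) ∨
        ((∀ n, A (x n) ≠ y) ∧ Sesop.WeaklyConverges x xdag)) := by
  obtain ⟨b, hb, hmin⟩ := Sesop.exists_solution_norm_lt (A := A) hy
  refine ⟨b, Sesop.isBregmanProjection_of_norm_lt hpq.pos hrun.initial hb hmin, hmin, ?_⟩
  by_cases hfin : ∃ n, A (x n) = y
  · classical
    left
    have hlt : ∀ m < Nat.find hfin, A (x m) ≠ y := fun m hm => Nat.find_min hfin hm
    have hsol : A (x (Nat.find hfin)) = y := Nat.find_spec hfin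
    refine ⟨Nat.find hfin, hlt, hsol, ?_⟩
    by_contra hne
    exact (hmin _ hsol hne).not_ge (Sesop.norm_le_of_dualityMap_mem_closure hpq.lt
      (hrun.dualityMap_mem_closure hX hpq _ hlt) ((show A b = y from hb).trans hsol.symm))
  · right
    push Not at hfin
    refine ⟨hfin, Sesop.weaklyConverges_iff.2 fun f =>
      tendsto_of_subseq_tendsto fun ψ hψ => ?_⟩
    -- The dual distance never exceeds its initial value, so coercivity gives one bound for all `n`.
    have hR : ∀ n, ‖x n‖ ≤ _ := fun n => Sesop.norm_le_of_dualDistance_le hpq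
      (hrun.antitone_dualDistance hX hpq hfin (fun n => (hN n).1) hb n.zero_le)
    have hres := hrun.tendsto_residual hX hpq hr hjY hfin (fun n => (hN n).1) hb hR
    obtain ⟨a, χ, hχ, ha⟩ := Sesop.exists_subseq_weaklyConverges (x := x ∘ ψ) fun n => hR (ψ n)
    refine ⟨χ, ?_⟩
    have hab : a = b := Sesop.eq_of_weaklyConverges hpq.lt hJ hb hmin ha
      (fun n => hrun.dualityMap_mem_closure hX hpq _ fun m _ => hfin m)
      (hres.comp (hψ.comp hχ.tendsto_atTop))
    rw [← hab]
    exact Sesop.weaklyConverges_iff.1 ha f
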